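/- Let $\mathbb{K}$ be a field of characteristic $0$ and let $L=(L,d,[-,-])$ be a ($\mathbb{Z}$-graded) differential graded Lie algebra over $\mathbb{K}$, with $d$ of degree $+1$. For a local Artin $\mathbb{K}$-algebra $A$ with residue field $\mathbb{K}$ and maximal ideal $\mathfrak{m}_A$ put \[ \operatorname{Def}_L(A)=\frac{\{x\in L^1\otimes\mathfrak{m}_A\mid dx+\frac12[x,x]=0\}}{\text{gauge action of }\exp(L^0\otimes\mathfrak{m}_A)},\qquad e^a\ast x=x+\sum_{n\ge 0}\frac{[a,-]^n}{(n+1)!}([a,x]-da), \] a functor of $A$, and put $\operatorname{Def}_L(\mathbb{K}[[t]]):=\varprojlim_{n\ge 1}\operatorname{Def}_L(\mathbb{K}[t]/(t^n))$. Suppose that $L$ is formal, i.e. that there exist DG-Lie algebras $M$ and $H$ over $\mathbb{K}$, with $H$ having trivial differential, and quasi-isomorphisms of DG-Lie algebras $L\leftarrow M\to H$. Then the two natural maps \[ \operatorname{Def}_L(\mathbb{K}[t]/(t^3))\to\operatorname{Def}_L(\mathbb{K}[t]/(t^2)),\qquad \operatorname{Def}_L(\mathbb{K}[[t]])\to\operatorname{Def}_L(\mathbb{K}[t]/(t^2))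 \] have the same image. -/

import Mathlib

open scoped TensorProduct Polynomial

universe u v w w₁ w₂

/-- A differential graded Lie algebra over `K`: a `ℤ`-graded vector space (given as an internal
direct sum), a differential of degree `+1` and a graded Lie bracket of degree `0`. -/
structure DGLieAlgebra (K : Type u) [Field K] where
  /-- The total space, the direct sum of all the homogeneous components. -/
  carrier : Type v
  [addCommGroup : AddCommGroup carrier]
  [module : Module K carrier]
  /-- The component of degree `i`. -/
  deg : ℤ → Submodule K carrier
  isInternal : DirectSum.IsInternal deg
  /-- The differential. -/
  d : carrier →ₗ[K] carrier
  d_mem : ∀ (i : ℤ) (x : carrier), x ∈ deg i → d x ∈ deg (i + 1)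
  d_d : ∀ x : carrier, d (d x) = 0
  /-- The bracket. -/
  bracket : carrier →ₗ[K] carrier →ₗ[K] carrier
  bracket_mem : ∀ (i j : ℤ) (x y : carrier), x ∈ deg i → y ∈ deg j →
    bracket x y ∈ deg (i + j)
  bracket_skew : ∀ (i j : ℤ) (x y : carrier), x ∈ deg i → y ∈ deg j →
    bracket x y = -((i * j).negOnePow • bracket y x)
  jacobi : ∀ (i j : ℤ) (x y z : carrier), x ∈ deg i → y ∈ deg j →
    bracket x (bracket y z) = bracket (bracket x y) z + (i * j).negOnePow • bracket y (bracket x z)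
  leibniz : ∀ (i : ℤ) (x y : carrier), x ∈ deg i →
    d (bracket x y) = bracket (d x) y + i.negOnePow • bracket x (d y)

namespace DGLieAlgebra

attribute [instance] DGLieAlgebra.addCommGroup DGLieAlgebra.module

variable {K : Type u} [Field K]

/-! ### Cohomology, quasi-isomorphisms and formality -/

/-- The space of cocycles of degree `i`. -/
def cocycles (L : DGLieAlgebra.{u, v} K) (i : ℤ) : Submodule K L.carrier :=
  L.deg i ⊓ LinearMap.ker L.d

/-- The space of coboundaries of degree `i`. -/
def coboundaries (L : DGLieAlgebra.{u, v} K) (i : ℤ) : Submodule K L.carrier :=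
  (L.deg (i - 1)).map L.d

/-- The cohomology `H^i(L)`. -/
abbrev Cohomology (L : DGLieAlgebra.{u, v} K) (i : ℤ) : Type v :=
  L.cocycles i ⧸ (L.coboundaries i).submoduleOf (L.cocycles i)

/-- A morphism of DG-Lie algebras. -/
structure Hom (L : DGLieAlgebra.{u, v} K) (M : DGLieAlgebra.{u, w} K) where
  /-- The underlying linear map. -/
  toLin : L.carrier →ₗ[K] M.carrier
  map_deg : ∀ (i : ℤ) (x : L.carrier), x ∈ L.deg i → toLin x ∈ M.deg i
  map_d : ∀ x : L.carrier, toLin (L.d x) = M.d (toLin x)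
  map_bracket : ∀ x y : L.carrier, toLin (L.bracket x y) = M.bracket (toLin x) (toLin y)

namespace Hom

variable {L : DGLieAlgebra.{u, v} K} {M : DGLieAlgebra.{u, w} K}

theorem map_cocycles (f : Hom L M) (i : ℤ) (x : L.carrier) (hx : x ∈ L.cocycles i) :
    f.toLin x ∈ M.cocycles i := by
  refine ⟨f.map_deg i x hx.1, ?_⟩
  have h : L.d x = 0 := hx.2
  change M.d (f.toLin x) = 0
  rw [← f.map_d, h, map_zero]

/-- The map induced by a morphism on cocycles. -/
def cocyclesMap (f : Hom L M) (i : ℤ) : L.cocycles i →ₗ[K] M.cocycles i :=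
  f.toLin.restrict (f.map_cocycles i)

/-- The map induced by a morphism on cohomology. -/
def cohomologyMap (f : Hom L M) (i : ℤ) : L.Cohomology i →ₗ[K] M.Cohomology i :=
  Submodule.mapQ _ _ (f.cocyclesMap i) (by
    rintro x ⟨y, hy, hyx⟩
    exact ⟨f.toLin y, f.map_deg _ _ hy, by
      rw [← f.map_d, hyx]; rfl⟩)

/-- A morphism of DG-Lie algebras is a quasi-isomorphism if it induces isomorphisms
in cohomology. -/
def IsQuasiIso (f : Hom L M) : Prop :=
  ∀ i : ℤ, Function.Bijective (f.cohomologyMap i)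

end Hom

/-- `L` is formal if there are quasi-isomorphisms of DG-Lie algebras `L ← M → H` with `H` having
trivial differential. -/
def IsFormal (L : DGLieAlgebra.{u, v} K) : Prop :=
  ∃ (M : DGLieAlgebra.{u, w₁} K) (H : DGLieAlgebra.{u, w₂} K) (f : Hom M L) (g : Hom M H),
    f.IsQuasiIso ∧ g.IsQuasiIso ∧ H.d = 0

/-! ### The DG-Lie algebra `L ⊗ A` and the gauge action -/

section Def

variable (L : DGLieAlgebra.{u, v} K) (A : Type w) [CommRing A] [Algebra K A]

/-- The differential `d ⊗ id` of `L ⊗ A`. -/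
noncomputable def tensorD : L.carrier ⊗[K] A →ₗ[K] L.carrier ⊗[K] A :=
  L.d.rTensor A

/-- The bracket of `L ⊗ A`, that is `[x ⊗ a, y ⊗ b] = [x, y] ⊗ ab`. -/
noncomputable def tensorBracket :
    L.carrier ⊗[K] A →ₗ[K] L.carrier ⊗[K] A →ₗ[K] L.carrier ⊗[K] A :=
  TensorProduct.map₂ L.bracket (LinearMap.mul K A)

/-- The subspace `L^i ⊗ 𝔪_A` of `L ⊗ A`. -/
noncomputable def tensorMax [IsLocalRing A] (i : ℤ) : Submodule K (L.carrier ⊗[K] A) :=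
  LinearMap.range (TensorProduct.map (L.deg i).subtype
    ((IsLocalRing.maximalIdeal A).restrictScalars K).subtype)

/-- The Maurer-Cartan elements `x ∈ L^1 ⊗ 𝔪_A`, `dx + [x,x]/2 = 0`. -/
def MaurerCartan [IsLocalRing A] : Type (max v w) :=
  {x : L.carrier ⊗[K] A //
    x ∈ L.tensorMax A 1 ∧ L.tensorD A x + (1 / 2 : K) • L.tensorBracket A x x = 0}

variable {A}

/-- The gauge action
`e^a * x = x + ∑ₙ [a,-]ⁿ([a,x] - da) / (n+1)!`. For `a ∈ L^0 ⊗ 𝔪_A` with `A` local Artinian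
only finitely many terms of the sum are different from zero, since `𝔪_A` is nilpotent. -/
noncomputable def gauge (a x : L.carrier ⊗[K] A) : L.carrier ⊗[K] A :=
  x + ∑ᶠ n : ℕ, ((n + 1).factorial : K)⁻¹ •
    ((L.tensorBracket A a) ^ n) (L.tensorBracket A a x - L.tensorD A a)

variable (A)

/-- Two Maurer-Cartan elements are related if some `e^a`, `a ∈ L^0 ⊗ 𝔪_A`, carries the first to
the second. -/
def GaugeRel [IsLocalRing A] (x y : L.MaurerCartan A) : Prop :=
  ∃ a ∈ L.tensorMax A 0, L.gauge a x.1 = y.1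

/-- `Def_L(A)`, for `A` a local Artin `K`-algebra: the quotient of the set of Maurer-Cartan
elements by the gauge action of `exp(L^0 ⊗ 𝔪_A)`. -/
def Def [IsLocalRing A] : Type (max v w) := Quot (L.GaugeRel A)

end Def

/-! ### Functoriality of `Def_L` -/

section Functoriality

variable (L : DGLieAlgebra.{u, v} K) {A : Type w₁} [CommRing A] [Algebra K A]
  {B : Type w₂} [CommRing B] [Algebra K B]

/-- The map `L ⊗ A → L ⊗ B` induced by `A → B`. -/
noncomputable def baseMap (φ : A →ₐ[K] B) : L.carrier ⊗[K] A →ₗ[K] L.carrier ⊗[K] B :=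
  φ.toLinearMap.lTensor L.carrier

theorem baseMap_tensorD (φ : A →ₐ[K] B) (x : L.carrier ⊗[K] A) :
    L.baseMap φ (L.tensorD A x) = L.tensorD B (L.baseMap φ x) := by
  induction x with
  | zero => simp
  | tmul x a => simp [baseMap, tensorD]
  | add x y hx hy => simp only [map_add, hx, hy]

theorem baseMap_tensorBracket (φ : A →ₐ[K] B) (x y : L.carrier ⊗[K] A) :
    L.baseMap φ (L.tensorBracket A x y) =
      L.tensorBracket B (L.baseMap φ x) (L.baseMap φ y) := by
  induction x with
  | zero => simp
  | add x x' hx hx' => simp only [map_add, LinearMap.add_apply, hx, hx']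
  | tmul x a =>
    induction y with
    | zero => simp
    | add y y' hy hy' => simp only [map_add, hy, hy']
    | tmul y b => simp [baseMap, tensorBracket]

theorem baseMap_iterate (φ : A →ₐ[K] B) (a x : L.carrier ⊗[K] A) (n : ℕ) :
    L.baseMap φ (((L.tensorBracket A a) ^ n) x) =
      ((L.tensorBracket B (L.baseMap φ a)) ^ n) (L.baseMap φ x) := by
  induction n with
  | zero => simp
  | succ n ih => simp only [pow_succ', Module.End.mul_apply, baseMap_tensorBracket, ih]

theorem isNilpotent_maximalIdeal (A : Type w₁) [CommRing A] [IsLocalRing A] [IsArtinianRing A] :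
    IsNilpotent (IsLocalRing.maximalIdeal A) := by
  have h := IsArtinianRing.isNilpotent_jacobson_bot (R := A)
  rwa [IsLocalRing.jacobson_eq_maximalIdeal ⊥ bot_ne_top] at h

theorem map_mem_maximalIdeal [IsLocalRing A] [IsArtinianRing A] [IsLocalRing B] (φ : A →ₐ[K] B)
    (a : A) (ha : a ∈ IsLocalRing.maximalIdeal A) : φ a ∈ IsLocalRing.maximalIdeal B := by
  obtain ⟨n, hn⟩ := isNilpotent_maximalIdeal A
  have h : a ^ n = 0 := by
    have := Ideal.pow_mem_pow ha n
    rwa [hn] at this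
  refine Ideal.IsPrime.mem_of_pow_mem (IsLocalRing.maximalIdeal.isMaximal B).isPrime n ?_
  rw [← map_pow, h, map_zero]
  exact Ideal.zero_mem _

theorem baseMap_mem_tensorMax [IsLocalRing A] [IsArtinianRing A] [IsLocalRing B]
    (φ : A →ₐ[K] B) (i : ℤ) (x : L.carrier ⊗[K] A) (hx : x ∈ L.tensorMax A i) :
    L.baseMap φ x ∈ L.tensorMax B i := by
  obtain ⟨y, rfl⟩ := hx
  induction y with
  | zero => simp
  | add y z hy hz => simpa only [map_add] using Submodule.add_mem _ hy hz
  | tmul y a =>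
    exact ⟨y ⊗ₜ ⟨φ a.1, map_mem_maximalIdeal φ a.1 a.2⟩, by simp [baseMap]⟩

/-- The subspace `L ⊗ I` of `L ⊗ A`. -/
noncomputable def tensorIdeal (I : Ideal A) : Submodule K (L.carrier ⊗[K] A) :=
  LinearMap.range ((I.restrictScalars K).subtype.lTensor L.carrier)

theorem bracket_mem_tensorIdeal [IsLocalRing A] (n : ℕ) (i : ℤ) (a x : L.carrier ⊗[K] A)
    (ha : a ∈ L.tensorMax A i) (hx : x ∈ L.tensorIdeal (IsLocalRing.maximalIdeal A ^ n)) :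
    L.tensorBracket A a x ∈ L.tensorIdeal (IsLocalRing.maximalIdeal A ^ (n + 1)) := by
  obtain ⟨a, rfl⟩ := ha
  obtain ⟨x, rfl⟩ := hx
  induction a with
  | zero => simp
  | add a b ha hb =>
    simpa only [map_add, LinearMap.add_apply] using Submodule.add_mem _ ha hb
  | tmul a s =>
    induction x with
    | zero => simp
    | add x y hx hy => simpa only [map_add] using Submodule.add_mem _ hx hy
    | tmul x t =>
      refine ⟨L.bracket a x ⊗ₜ ⟨s.1 * t.1, ?_⟩, by simp [tensorBracket]⟩
      change s.1 * t.1 ∈ IsLocalRing.maximalIdeal A ^ (n + 1)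
      rw [pow_succ']
      exact Ideal.mul_mem_mul s.2 t.2

theorem iterate_mem_tensorIdeal [IsLocalRing A] (n : ℕ) (i : ℤ) (a x : L.carrier ⊗[K] A)
    (ha : a ∈ L.tensorMax A i) :
    ((L.tensorBracket A a) ^ n) x ∈ L.tensorIdeal (IsLocalRing.maximalIdeal A ^ n) := by
  induction n with
  | zero =>
    induction x with
    | zero => simp
    | add x y hx hy => simpa only [map_add] using Submodule.add_mem _ hx hy
    | tmul x t => exact ⟨x ⊗ₜ ⟨t, by simp⟩, by simp⟩
  | succ n ih =>
    rw [pow_succ' (L.tensorBracket A a), Module.End.mul_apply]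
    exact L.bracket_mem_tensorIdeal n i a _ ha ih

theorem gauge_support_finite [IsLocalRing A] [IsArtinianRing A] (a y : L.carrier ⊗[K] A)
    (ha : a ∈ L.tensorMax A 0) :
    (Function.support fun n : ℕ => ((n + 1).factorial : K)⁻¹ •
      ((L.tensorBracket A a) ^ n) y).Finite := by
  obtain ⟨N, hN⟩ := isNilpotent_maximalIdeal A
  refine (Set.finite_lt_nat N).subset fun n hn => ?_
  by_contra hlt
  have hle : N ≤ n := not_lt.mp hlt
  apply hn
  have h := L.iterate_mem_tensorIdeal n 0 a y ha
  have h0 : IsLocalRing.maximalIdeal A ^ n = ⊥ :=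
    le_bot_iff.mp ((Ideal.pow_le_pow_right hle).trans hN.le)
  rw [h0] at h
  obtain ⟨z, hz⟩ := h
  have hz0 : z = 0 := by
    clear hz
    induction z with
    | zero => rfl
    | add z w hz hw => rw [hz, hw, add_zero]
    | tmul z t =>
      have : t = 0 := Subtype.ext t.2
      rw [this, TensorProduct.tmul_zero]
  rw [hz0, map_zero] at hz
  simp [← hz]

theorem baseMap_gauge [IsLocalRing A] [IsArtinianRing A] (φ : A →ₐ[K] B)
    (a x : L.carrier ⊗[K] A) (ha : a ∈ L.tensorMax A 0) :
    L.baseMap φ (L.gauge a x) = L.gauge (L.baseMap φ a) (L.baseMap φ x) := by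
  unfold gauge
  rw [map_add]
  congr 1
  have h := AddMonoidHom.map_finsum (L.baseMap φ).toAddMonoidHom
    (L.gauge_support_finite a (L.tensorBracket A a x - L.tensorD A a) ha)
  refine h.trans (finsum_congr fun n => ?_)
  change L.baseMap φ _ = _
  rw [map_smul, baseMap_iterate, map_sub, baseMap_tensorBracket, baseMap_tensorD]

variable [IsLocalRing A] [IsArtinianRing A] [IsLocalRing B]

/-- The map induced on Maurer-Cartan elements by a morphism of local Artin `K`-algebras. -/
noncomputable def MaurerCartan.map (φ : A →ₐ[K] B) (x : L.MaurerCartan A) : L.MaurerCartan B :=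
  ⟨L.baseMap φ x.1, L.baseMap_mem_tensorMax φ 1 x.1 x.2.1, by
    rw [← baseMap_tensorD, ← baseMap_tensorBracket, ← map_smul, ← map_add, x.2.2, map_zero]⟩

/-- The map `Def_L(A) → Def_L(B)` induced by a morphism of local Artin `K`-algebras. -/
noncomputable def Def.map (φ : A →ₐ[K] B) : L.Def A → L.Def B :=
  Quot.map (MaurerCartan.map L φ) (by
    rintro x y ⟨a, ha, hxy⟩
    refine ⟨L.baseMap φ a, L.baseMap_mem_tensorMax φ 0 a ha, ?_⟩
    change L.gauge (L.baseMap φ a) (L.baseMap φ x.1) = L.baseMap φ y.1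
    rw [← hxy, baseMap_gauge L φ a x.1 ha])

end Functoriality

end DGLieAlgebra

/-! ### The algebras `K[t]/(t^n)` -/

/-- The algebra `K[t]/(t^n)`. -/
abbrev TruncPoly (K : Type u) [Field K] (n : ℕ) : Type u :=
  K[X] ⧸ Ideal.span {(Polynomial.X : K[X]) ^ n}

namespace TruncPoly

variable (K : Type u) [Field K]

instance instIsArtinianRing (n : ℕ) : IsArtinianRing (TruncPoly K n) := by
  have : Module.Finite K (TruncPoly K n) := (Polynomial.monic_X_pow n).finite_quotient
  exact IsArtinianRing.of_finite K _

instance instIsLocalRing (n : ℕ) [NeZero n] : IsLocalRing (TruncPoly K n) := by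
  set I : Ideal K[X] := Ideal.span {(Polynomial.X : K[X]) ^ n} with hI
  have hX : IsNilpotent (Ideal.Quotient.mk I Polynomial.X) :=
    ⟨n, by
      rw [← map_pow, Ideal.Quotient.eq_zero_iff_mem]
      exact Ideal.mem_span_singleton_self _⟩
  have hne : I ≠ ⊤ := by
    rw [hI, Ne, Ideal.span_singleton_eq_top, isUnit_pow_iff (NeZero.ne n)]
    exact Polynomial.not_isUnit_X
  have : Nontrivial (K[X] ⧸ I) := Ideal.Quotient.nontrivial_iff.mpr hne
  have hunit : ∀ p : K[X], p.coeff 0 ≠ 0 → IsUnit (Ideal.Quotient.mk I p) := by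
    intro p hp
    have h1 : IsUnit (Ideal.Quotient.mk I (Polynomial.C (p.coeff 0))) :=
      ((isUnit_iff_ne_zero.mpr hp).map Polynomial.C).map _
    have h2 : IsNilpotent (Ideal.Quotient.mk I (Polynomial.X * p.divX)) := by
      rw [map_mul]
      exact (Commute.all _ _).isNilpotent_mul_right hX
    have h3 := h2.isUnit_add_left_of_commute h1 (Commute.all _ _)
    rwa [← map_add, add_comm, Polynomial.X_mul_divX_add] at h3
  refine IsLocalRing.of_isUnit_or_isUnit_one_sub_self fun a => ?_
  obtain ⟨p, rfl⟩ := Ideal.Quotient.mk_surjective a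
  by_cases hp : p.coeff 0 = 0
  · right
    rw [← map_one (Ideal.Quotient.mk I), ← map_sub]
    exact hunit _ (by simp [hp])
  · exact Or.inl (hunit p hp)

/-- The projection `K[t]/(t^n) → K[t]/(t^m)`, `m ≤ n`. -/
noncomputable def proj {m n : ℕ} (h : m ≤ n) : TruncPoly K n →ₐ[K] TruncPoly K m :=
  Ideal.Quotient.factorₐ K (Ideal.span_singleton_le_span_singleton.mpr (pow_dvd_pow _ h))

end TruncPoly

namespace DGLieAlgebra

variable {K : Type u} [Field K]

/-- `Def_L(K[[t]])`, the inverse limit of the sets `Def_L(K[t]/(t^n))`, `n ≥ 1`. -/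
def DefPowerSeries (L : DGLieAlgebra.{u, v} K) : Type (max u v) :=
  {s : ∀ (n : ℕ) [NeZero n], L.Def (TruncPoly K n) //
    ∀ (m n : ℕ) [NeZero m] [NeZero n] (h : m ≤ n), Def.map L (TruncPoly.proj K h) (s n) = s m}

/-- The canonical map `Def_L(K[[t]]) → Def_L(K[t]/(t^n))`. -/
def DefPowerSeries.eval (L : DGLieAlgebra.{u, v} K) (n : ℕ) [NeZero n] (s : L.DefPowerSeries) :
    L.Def (TruncPoly K n) :=
  s.1 n

end DGLieAlgebra

/-!
A Maurer-Cartan element over `K[t]/(t^3)` with linear term `x` exists if and only if `dx = 0` and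
`[x,x]` is a coboundary, and over `K[t]/(t^2)` the gauge action changes `x` by coboundaries. So a
class in `Def_L(K[t]/(t^2))` that lifts to `K[t]/(t^3)` is given by an element of `H^1(L)` with
vanishing square, and transporting it along the two quasi-isomorphisms `g : M → H` and `f : M → L`
gives a cocycle `x ∈ M^1` with `[g x, g x] = 0` in `H`.

Such an `x` is the linear term of a Maurer-Cartan series `y` in `M`, found recursively. If `y`
solves the Maurer-Cartan equation below order `n`, the Bianchi identity `dF = [F,y]` for the
curvature `F = dy + [y,y]/2` shows that the obstruction, the coefficient of `tⁿ` in `[y,y]`, is a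
cocycle. If moreover all the coefficients of `y` after the first lie in `ker g`, so does the
obstruction, hence it has a primitive, and this can again be chosen in `ker g` because `H` has no
differential. The series `f y` in `L` is Maurer-Cartan over every `K[t]/(t^n)` at once.
-/

open Finset

section Antidiagonal

variable {A M : Type*} [AddCommMonoid A] [HasAntidiagonal A] [AddCommMonoid M]

theorem sum_antidiagonal_antidiagonal_assoc (n : A) (F : A → A → A → M) :
    ∑ p ∈ antidiagonal n, ∑ q ∈ antidiagonal p.1, F q.1 q.2 p.2 =
      ∑ p ∈ antidiagonal n, ∑ q ∈ antidiagonal p.2, F p.1 q.1 q.2 := by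
  simp only [sum_sigma']
  apply sum_nbij' (fun ⟨⟨_, c⟩, ⟨a, b⟩⟩ ↦ ⟨(a, b + c), (b, c)⟩)
    (fun ⟨⟨a, _⟩, ⟨b, c⟩⟩ ↦ ⟨(a + b, c), (a, b)⟩) <;>
    grind [HasAntidiagonal.mem_antidiagonal]

theorem sum_antidiagonal_antidiagonal_left_comm (n : A) (F : A → A → A → M) :
    ∑ p ∈ antidiagonal n, ∑ q ∈ antidiagonal p.2, F q.1 p.1 q.2 =
      ∑ p ∈ antidiagonal n, ∑ q ∈ antidiagonal p.2, F p.1 q.1 q.2 := by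
  simp only [sum_sigma']
  apply sum_nbij' (fun ⟨⟨a, _⟩, ⟨b, c⟩⟩ ↦ ⟨(b, a + c), (a, c)⟩)
    (fun ⟨⟨a, _⟩, ⟨b, c⟩⟩ ↦ ⟨(b, a + c), (a, c)⟩) <;>
    grind [HasAntidiagonal.mem_antidiagonal]

end Antidiagonal

theorem sum_range_sum_range_eq_sum_antidiagonal {M : Type*} [AddCommMonoid M] {n : ℕ}
    {F : ℕ → ℕ → M} (hF : ∀ i j, n ≤ i + j → F i j = 0) :
    ∑ i ∈ range n, ∑ j ∈ range n, F i j =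
      ∑ k ∈ range n, ∑ p ∈ antidiagonal k, F p.1 p.2 := by
  simp only [Nat.sum_antidiagonal_eq_sum_range_succ F]
  rw [sum_range_diag_flip n F]
  refine sum_congr rfl fun i _ ↦ (sum_subset (range_mono (n.sub_le i)) fun j _ hj ↦ hF i j ?_).symm
  rw [mem_range] at hj
  omega

namespace DGLieAlgebra

variable {K : Type u} [Field K]

namespace Hom

variable {L : DGLieAlgebra.{u, v} K} {M : DGLieAlgebra.{u, w} K} (f : Hom L M) {i : ℤ}

theorem exists_cocycle_of_surjective (hf : Function.Surjective (f.cohomologyMap i))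
    {z : M.carrier} (hz : z ∈ M.cocycles i) :
    ∃ x ∈ L.cocycles i, ∃ b ∈ M.deg (i - 1), f.toLin x = z + M.d b := by
  obtain ⟨q, hq⟩ := hf (Submodule.Quotient.mk ⟨z, hz⟩)
  obtain ⟨x, rfl⟩ := Submodule.Quotient.mk_surjective _ q
  obtain ⟨b, hb, hbz⟩ := (Submodule.Quotient.eq _).mp hq
  exact ⟨x, x.2, b, hb, sub_eq_iff_eq_add'.mp hbz.symm⟩

theorem mem_coboundaries_of_injective (hf : Function.Injective (f.cohomologyMap i))
    {x : L.carrier} (hx : x ∈ L.cocycles i) (hfx : f.toLin x ∈ M.coboundaries i) :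
    x ∈ L.coboundaries i := by
  have h : f.cohomologyMap i (Submodule.Quotient.mk ⟨x, hx⟩) = 0 :=
    (Submodule.Quotient.mk_eq_zero _).mpr hfx
  have h0 := hf (h.trans (map_zero _).symm)
  rw [Submodule.Quotient.mk_eq_zero] at h0
  exact h0

theorem exists_primitive_mem_ker (hf : Function.Surjective (f.cohomologyMap i))
    (hf' : Function.Injective (f.cohomologyMap (i + 1))) (hM : M.d = 0) {c : L.carrier}
    (hc : c ∈ L.cocycles (i + 1)) (hfc : f.toLin c = 0) :
    ∃ w ∈ L.deg i ⊓ LinearMap.ker f.toLin, L.d w = c := by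
  obtain ⟨w, hw, rfl⟩ := f.mem_coboundaries_of_injective hf' hc (hfc ▸ Submodule.zero_mem _)
  rw [add_sub_cancel_right] at hw
  obtain ⟨z, hz, b, -, hzb⟩ := f.exists_cocycle_of_surjective hf
    (z := f.toLin w) ⟨f.map_deg i w hw, by simp [hM]⟩
  refine ⟨w - z, ⟨Submodule.sub_mem _ hw hz.1, ?_⟩, ?_⟩
  · simp [hzb, hM]
  · rw [map_sub, LinearMap.mem_ker.mp hz.2, sub_zero]

theorem exists_forall_mem_ker_d_eq (hf : Function.Surjective (f.cohomologyMap i))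
    (hf' : Function.Injective (f.cohomologyMap (i + 1))) (hM : M.d = 0) :
    ∃ s : L.carrier → L.carrier, (∀ c, s c ∈ L.deg i ⊓ LinearMap.ker f.toLin) ∧
      ∀ c ∈ L.cocycles (i + 1), f.toLin c = 0 → L.d (s c) = c := by
  have h (c : L.carrier) : ∃ w ∈ L.deg i ⊓ LinearMap.ker f.toLin,
      c ∈ L.cocycles (i + 1) → f.toLin c = 0 → L.d w = c := by
    by_cases hc : c ∈ L.cocycles (i + 1) ∧ f.toLin c = 0
    · obtain ⟨w, hw, hdw⟩ := f.exists_primitive_mem_ker hf hf' hM hc.1 hc.2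
      exact ⟨w, hw, fun _ _ ↦ hdw⟩
    · exact ⟨0, Submodule.zero_mem _, fun h h' ↦ absurd ⟨h, h'⟩ hc⟩
  choose s hs hds using h
  exact ⟨s, hs, hds⟩

end Hom

section Cocycles

variable (L : DGLieAlgebra.{u, v} K) {i j : ℤ} {x y : L.carrier}

theorem bracket_mem_cocycles (hx : x ∈ L.cocycles i) (hy : y ∈ L.cocycles j) :
    L.bracket x y ∈ L.cocycles (i + j) := by
  refine ⟨L.bracket_mem i j x y hx.1 hy.1, ?_⟩
  change L.d _ = 0
  rw [L.leibniz i x y hx.1, LinearMap.mem_ker.mp hx.2,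
    LinearMap.mem_ker.mp hy.2]
  simp

theorem bracket_mem_coboundaries (hx : x ∈ L.coboundaries i) (hy : y ∈ L.cocycles j) :
    L.bracket x y ∈ L.coboundaries (i + j) := by
  obtain ⟨a, ha, rfl⟩ := hx
  refine ⟨L.bracket a y, ?_, ?_⟩
  · rw [add_sub_right_comm]
    exact L.bracket_mem _ _ _ _ ha hy.1
  · rw [L.leibniz _ _ _ ha, LinearMap.mem_ker.mp hy.2]
    simp

theorem coboundaries_le_cocycles (i : ℤ) : L.coboundaries i ≤ L.cocycles i := by
  rintro _ ⟨a, ha, rfl⟩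
  exact ⟨sub_add_cancel i 1 ▸ L.d_mem _ a ha, L.d_d a⟩

theorem bracket_self_add_mem_coboundaries (hx : x ∈ L.cocycles i)
    (hy : y ∈ L.coboundaries i) (hxx : L.bracket x x ∈ L.coboundaries (i + i)) :
    L.bracket (x + y) (x + y) ∈ L.coboundaries (i + i) := by
  have hy' := L.coboundaries_le_cocycles i hy
  have hyx := L.bracket_mem_coboundaries hy hx
  have hxy : L.bracket x y ∈ L.coboundaries (i + i) := by
    rw [L.bracket_skew i i x y hx.1 hy'.1, Units.smul_def]
    exact neg_mem (zsmul_mem hyx _)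
  simp only [map_add, LinearMap.add_apply]
  exact add_mem (add_mem hxx hyx) (add_mem hxy (L.bracket_mem_coboundaries hy hy'))

end Cocycles

/-! ### Formal series with coefficients in a DG-Lie algebra -/

section Series

variable (L : DGLieAlgebra.{u, v} K)

/-- The differential of `L[[t]]`; the sequence `y` stands for the formal series `∑ yᵢ tⁱ`. -/
def seriesD : (ℕ → L.carrier) →ₗ[K] ℕ → L.carrier :=
  L.d.compLeft ℕ

/-- The `K[[t]]`-bilinear extension of the bracket of `L` to `L[[t]]`. -/
def seriesBracket : (ℕ → L.carrier) →ₗ[K] (ℕ → L.carrier) →ₗ[K] ℕ → L.carrier :=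
  LinearMap.mk₂ K (fun x y n ↦ ∑ p ∈ antidiagonal n, L.bracket (x p.1) (y p.2))
    (fun _ _ _ ↦ by ext; simp [sum_add_distrib]) (fun _ _ _ ↦ by ext; simp [smul_sum])
    (fun _ _ _ ↦ by ext; simp [sum_add_distrib]) (fun _ _ _ ↦ by ext; simp [smul_sum])

/-- The left-hand side `dy + [y,y]/2` of the Maurer-Cartan equation in `L[[t]]`. -/
def seriesCurvature (y : ℕ → L.carrier) : ℕ → L.carrier :=
  L.seriesD y + (1 / 2 : K) • L.seriesBracket y y

/-- The Maurer-Cartan elements of `t L^1[[t]]`. -/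
structure IsMaurerCartanSeries (y : ℕ → L.carrier) : Prop where
  coeff_zero : y 0 = 0
  mem : ∀ n, y n ∈ L.deg 1
  curvature_eq_zero : L.seriesCurvature y = 0

variable {L} {i j : ℤ} {x y z : ℕ → L.carrier}

theorem seriesD_apply (y : ℕ → L.carrier) (n : ℕ) : L.seriesD y n = L.d (y n) := rfl

theorem seriesBracket_apply (x y : ℕ → L.carrier) (n : ℕ) :
    L.seriesBracket x y n = ∑ p ∈ antidiagonal n, L.bracket (x p.1) (y p.2) := rfl

theorem seriesCurvature_apply (y : ℕ → L.carrier) (n : ℕ) :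
    L.seriesCurvature y n = L.d (y n) + (1 / 2 : K) • L.seriesBracket y y n := rfl

theorem seriesBracket_apply_zero (hx : x 0 = 0) : L.seriesBracket x y 0 = 0 := by
  simp [seriesBracket_apply, hx]

theorem seriesBracket_apply_one (hx : x 0 = 0) (hy : y 0 = 0) : L.seriesBracket x y 1 = 0 := by
  simp [seriesBracket_apply, Nat.sum_antidiagonal_succ, hx, hy]

theorem seriesBracket_apply_add_two (hx : x 0 = 0) (hy : y 0 = 0) (n : ℕ) :
    L.seriesBracket x y (n + 2) =
      ∑ p ∈ antidiagonal n, L.bracket (x (p.1 + 1)) (y (p.2 + 1)) := by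
  rw [seriesBracket_apply, Nat.sum_antidiagonal_succ, Nat.sum_antidiagonal_succ']
  simp [hx, hy]

theorem seriesBracket_mem (hx : ∀ n, x n ∈ L.deg i) (hy : ∀ n, y n ∈ L.deg j) (n : ℕ) :
    L.seriesBracket x y n ∈ L.deg (i + j) := by
  rw [seriesBracket_apply]
  exact Submodule.sum_mem _ fun p _ ↦ L.bracket_mem i j _ _ (hx p.1) (hy p.2)

theorem seriesBracket_skew (hx : ∀ n, x n ∈ L.deg i) (hy : ∀ n, y n ∈ L.deg j) :
    L.seriesBracket x y = -((i * j).negOnePow • L.seriesBracket y x) := by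
  ext n
  rw [Pi.neg_apply, Pi.smul_apply, seriesBracket_apply, seriesBracket_apply, smul_sum,
    ← sum_neg_distrib, ← Nat.sum_antidiagonal_swap]
  exact sum_congr rfl fun p _ ↦ L.bracket_skew i j _ _ (hx _) (hy _)

theorem seriesD_seriesBracket (hx : ∀ n, x n ∈ L.deg i) :
    L.seriesD (L.seriesBracket x y) =
      L.seriesBracket (L.seriesD x) y + i.negOnePow • L.seriesBracket x (L.seriesD y) := by
  ext n
  simp only [Pi.add_apply, Pi.smul_apply, seriesD_apply, seriesBracket_apply, map_sum, smul_sum,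
    ← sum_add_distrib]
  exact sum_congr rfl fun p _ ↦ L.leibniz i _ _ (hx _)

theorem seriesBracket_jacobi (hx : ∀ n, x n ∈ L.deg i) (hy : ∀ n, y n ∈ L.deg j) :
    L.seriesBracket x (L.seriesBracket y z) = L.seriesBracket (L.seriesBracket x y) z +
      (i * j).negOnePow • L.seriesBracket y (L.seriesBracket x z) := by
  ext n
  simp only [Pi.add_apply, Pi.smul_apply, seriesBracket_apply, map_sum, LinearMap.sum_apply]
  rw [sum_antidiagonal_antidiagonal_assoc n fun a b c ↦ L.bracket (L.bracket (x a) (y b)) (z c),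
    ← sum_antidiagonal_antidiagonal_left_comm n
      fun a b c ↦ L.bracket (y a) (L.bracket (x b) (z c))]
  simp only [smul_sum, ← sum_add_distrib]
  exact sum_congr rfl fun p _ ↦ sum_congr rfl fun q _ ↦ L.jacobi i j _ _ _ (hx _) (hy _)

theorem seriesBracket_seriesBracket_self [NeZero (3 : K)] (hy : ∀ n, y n ∈ L.deg 1) :
    L.seriesBracket (L.seriesBracket y y) y = 0 := by
  have hskew :
      L.seriesBracket y (L.seriesBracket y y) = -L.seriesBracket (L.seriesBracket y y) y := by
    rw [seriesBracket_skew hy (seriesBracket_mem hy hy), Int.negOnePow_even _ (by decide), one_smul]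
  have hjacobi := seriesBracket_jacobi (z := y) hy hy
  rw [hskew, Int.negOnePow_odd _ (by decide), Units.neg_smul, one_smul, neg_neg,
    neg_eq_iff_add_eq_zero] at hjacobi
  have h3 : (3 : K) • L.seriesBracket (L.seriesBracket y y) y = 0 := by
    rw [← hjacobi]
    module
  exact (smul_eq_zero.mp h3).resolve_left (NeZero.ne _)

theorem seriesD_seriesCurvature [NeZero (2 : K)] [NeZero (3 : K)] (hy : ∀ n, y n ∈ L.deg 1) :
    L.seriesD (L.seriesCurvature y) = L.seriesBracket (L.seriesCurvature y) y := by
  have hdd : L.seriesD (L.seriesD y) = 0 := funext fun n ↦ L.d_d (y n)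
  have hskew : L.seriesBracket y (L.seriesD y) = -L.seriesBracket (L.seriesD y) y := by
    rw [seriesBracket_skew (y := L.seriesD y) hy fun n ↦ L.d_mem 1 _ (hy n),
      Int.negOnePow_even _ (by decide), one_smul]
  have hleibniz :
      L.seriesD (L.seriesBracket y y) = (2 : K) • L.seriesBracket (L.seriesD y) y := by
    rw [seriesD_seriesBracket hy, hskew, Int.negOnePow_one, Units.neg_smul, one_smul, neg_neg,
      two_smul]
  rw [seriesCurvature, map_add, map_smul, hdd, hleibniz, map_add, map_smul, LinearMap.add_apply,
    LinearMap.smul_apply, seriesBracket_seriesBracket_self hy, smul_smul,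
    one_div_mul_cancel (NeZero.ne _)]
  module

theorem seriesBracket_self_mem_cocycles [NeZero (2 : K)] [NeZero (3 : K)] {n : ℕ}
    (hy₀ : y 0 = 0) (hy : ∀ n, y n ∈ L.deg 1) (h : ∀ m < n, L.seriesCurvature y m = 0) :
    L.seriesBracket y y n ∈ L.cocycles 2 := by
  have hd : L.d (L.seriesCurvature y n) = 0 := by
    rw [← seriesD_apply, seriesD_seriesCurvature hy, seriesBracket_apply]
    refine sum_eq_zero fun p hp ↦ ?_
    rw [HasAntidiagonal.mem_antidiagonal] at hp
    rcases Nat.eq_zero_or_pos p.2 with hp₂ | hp₂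
    · rw [hp₂, hy₀, map_zero]
    · rw [h p.1 (by omega), map_zero, LinearMap.zero_apply]
  rw [seriesCurvature_apply, map_add, L.d_d, zero_add, map_smul] at hd
  exact ⟨seriesBracket_mem hy hy n,
    (smul_eq_zero.mp hd).resolve_left (one_div_ne_zero (NeZero.ne _))⟩

theorem coeff_one_mem_cocycles (hy₀ : y 0 = 0) (hy : y 1 ∈ L.deg 1)
    (h : L.seriesCurvature y 1 = 0) : y 1 ∈ L.cocycles 1 := by
  rw [seriesCurvature_apply, seriesBracket_apply_one hy₀ hy₀, smul_zero, add_zero] at h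
  exact ⟨hy, h⟩

theorem bracket_coeff_one_mem_coboundaries [NeZero (2 : K)] (hy₀ : y 0 = 0) (hy : y 2 ∈ L.deg 1)
    (h : L.seriesCurvature y 2 = 0) : L.bracket (y 1) (y 1) ∈ L.coboundaries 2 := by
  rw [seriesCurvature_apply, seriesBracket_apply_add_two hy₀ hy₀, Nat.antidiagonal_zero,
    sum_singleton, add_eq_zero_iff_neg_eq] at h
  refine ⟨-((2 : K) • y 2), Submodule.neg_mem _ (Submodule.smul_mem _ _ hy), ?_⟩
  rw [← smul_neg, map_smul, map_neg, h, smul_smul, mul_one_div_cancel (NeZero.ne _), one_smul]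

theorem isMaurerCartanSeries_of_forall_mem_cocycles [NeZero (2 : K)] [NeZero (3 : K)]
    (hy₀ : y 0 = 0) (hy : ∀ n, y n ∈ L.deg 1)
    (h : ∀ n, L.seriesBracket y y n ∈ L.cocycles 2 →
      L.d (y n) = -((1 / 2 : K) • L.seriesBracket y y n)) :
    L.IsMaurerCartanSeries y := by
  refine ⟨hy₀, hy, funext fun n ↦ ?_⟩
  induction n using Nat.strong_induction_on with
  | _ n ih =>
    rw [seriesCurvature_apply, h n (seriesBracket_self_mem_cocycles hy₀ hy ih), neg_add_cancel,
      Pi.zero_apply]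

/-- The solution of the Kuranishi equation `y = x t - s [y,y] / 2`, computed recursively: the
coefficient of `tⁿ⁺²` in `[y,y]` only involves the coefficients of `t, …, tⁿ⁺¹` in `y`. -/
def kuranishiSeries (s : L.carrier → L.carrier) (x : L.carrier) : ℕ → L.carrier
  | 0 => 0
  | 1 => x
  | n + 2 => -((1 / 2 : K) • s (∑ i : Fin (n + 1),
      L.bracket (kuranishiSeries s x (i + 1)) (kuranishiSeries s x (n - i + 1))))

theorem kuranishiSeries_zero (s : L.carrier → L.carrier) (x : L.carrier) :
    kuranishiSeries s x 0 = 0 := by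
  rw [kuranishiSeries]

theorem kuranishiSeries_one (s : L.carrier → L.carrier) (x : L.carrier) :
    kuranishiSeries s x 1 = x := by
  rw [kuranishiSeries]

theorem kuranishiSeries_add_two (s : L.carrier → L.carrier) (x : L.carrier) (n : ℕ) :
    kuranishiSeries s x (n + 2) =
      -((1 / 2 : K) • s (L.seriesBracket (kuranishiSeries s x) (kuranishiSeries s x) (n + 2))) := by
  rw [seriesBracket_apply_add_two (kuranishiSeries_zero s x) (kuranishiSeries_zero s x),
    Nat.sum_antidiagonal_eq_sum_range_succ_mk, kuranishiSeries, ← Fin.sum_univ_eq_sum_range]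

end Series

/-! ### Maurer-Cartan series on formal DG-Lie algebras -/

namespace Hom

variable {L : DGLieAlgebra.{u, v} K} {M : DGLieAlgebra.{u, w} K} (f : Hom L M)

theorem map_seriesBracket (x y : ℕ → L.carrier) (n : ℕ) :
    f.toLin (L.seriesBracket x y n) = M.seriesBracket (f.toLin ∘ x) (f.toLin ∘ y) n := by
  simp [seriesBracket_apply, f.map_bracket]

theorem map_mem_coboundaries {i : ℤ} {x : L.carrier} (hx : x ∈ L.coboundaries i) :
    f.toLin x ∈ M.coboundaries i := by
  obtain ⟨a, ha, rfl⟩ := hx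
  exact ⟨f.toLin a, f.map_deg _ a ha, (f.map_d a).symm⟩

theorem isMaurerCartanSeries_comp {y : ℕ → L.carrier} (hy : L.IsMaurerCartanSeries y) :
    M.IsMaurerCartanSeries (f.toLin ∘ y) where
  coeff_zero := by simp [hy.coeff_zero]
  mem n := f.map_deg 1 _ (hy.mem n)
  curvature_eq_zero := funext fun n ↦ by
    have h := congrArg f.toLin (congrFun hy.curvature_eq_zero n)
    rwa [seriesCurvature_apply, map_add, map_smul, f.map_d, map_seriesBracket, Pi.zero_apply,
      map_zero] at h

theorem map_seriesBracket_self_eq_zero {y : ℕ → L.carrier} (hy₀ : y 0 = 0)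
    (hy₁ : f.toLin (L.bracket (y 1) (y 1)) = 0) (hy : ∀ n, f.toLin (y (n + 2)) = 0) :
    ∀ n, f.toLin (L.seriesBracket y y n) = 0
  | 0 => by rw [seriesBracket_apply_zero hy₀, map_zero]
  | 1 => by rw [seriesBracket_apply_one hy₀ hy₀, map_zero]
  | n + 2 => by
    rw [seriesBracket_apply_add_two hy₀ hy₀, map_sum]
    refine sum_eq_zero fun p _ ↦ ?_
    rcases p with ⟨_ | i, _ | j⟩
    · exact hy₁
    all_goals simp [hy, f.map_bracket]

theorem exists_isMaurerCartanSeries_of_map_bracket_self_eq_zero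
    [NeZero (2 : K)] [NeZero (3 : K)] (hf : Function.Surjective (f.cohomologyMap 1))
    (hf' : Function.Injective (f.cohomologyMap 2)) (hM : M.d = 0) {x : L.carrier}
    (hx : x ∈ L.cocycles 1) (hxx : f.toLin (L.bracket x x) = 0) :
    ∃ y, L.IsMaurerCartanSeries y ∧ y 1 = x := by
  obtain ⟨s, hs, hds⟩ := f.exists_forall_mem_ker_d_eq hf hf' hM
  have hy₀ := kuranishiSeries_zero s x
  have hy₁ := kuranishiSeries_one s x
  have hmem (n : ℕ) : kuranishiSeries s x (n + 2) ∈ L.deg 1 ⊓ LinearMap.ker f.toLin :=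
    kuranishiSeries_add_two s x n ▸ Submodule.neg_mem _ (Submodule.smul_mem _ _ (hs _))
  have hy : ∀ n, kuranishiSeries s x n ∈ L.deg 1
    | 0 => hy₀.symm ▸ Submodule.zero_mem _
    | 1 => by rw [hy₁]; exact hx.1
    | n + 2 => (hmem n).1
  have hfy : ∀ n, f.toLin (L.seriesBracket (kuranishiSeries s x) (kuranishiSeries s x) n) = 0 :=
    f.map_seriesBracket_self_eq_zero hy₀ (by rwa [hy₁]) fun n ↦ (hmem n).2
  refine ⟨kuranishiSeries s x,
    isMaurerCartanSeries_of_forall_mem_cocycles hy₀ hy fun n hn ↦ ?_, hy₁⟩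
  match n with
  | 0 => rw [hy₀, seriesBracket_apply_zero hy₀, map_zero, smul_zero, neg_zero]
  | 1 =>
    rw [hy₁, seriesBracket_apply_one hy₀ hy₀, smul_zero, neg_zero]
    exact hx.2
  | n + 2 => rw [kuranishiSeries_add_two, map_neg, map_smul, hds _ hn (hfy _)]

end Hom

theorem exists_isMaurerCartanSeries [NeZero (2 : K)] [NeZero (3 : K)]
    {L : DGLieAlgebra.{u, v} K} {M : DGLieAlgebra.{u, w₁} K} {H : DGLieAlgebra.{u, w₂} K}
    (f : Hom M L) (g : Hom M H) (hf : Function.Surjective (f.cohomologyMap 1))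
    (hf' : Function.Injective (f.cohomologyMap 2)) (hg : Function.Surjective (g.cohomologyMap 1))
    (hg' : Function.Injective (g.cohomologyMap 2)) (hH : H.d = 0) {x : L.carrier}
    (hx : x ∈ L.cocycles 1) (hxx : L.bracket x x ∈ L.coboundaries 2) :
    ∃ y, L.IsMaurerCartanSeries y ∧ ∃ a ∈ L.deg 0, y 1 = x + L.d a := by
  obtain ⟨z, hz, a, ha, hza⟩ := f.exists_cocycle_of_surjective hf hx
  have hzz : L.bracket (f.toLin z) (f.toLin z) ∈ L.coboundaries 2 :=
    hza ▸ L.bracket_self_add_mem_coboundaries hx ⟨a, ha, rfl⟩ hxx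
  rw [← f.map_bracket] at hzz
  have hgz : g.toLin (M.bracket z z) = 0 := by
    obtain ⟨b, -, hb⟩ := g.map_mem_coboundaries
      (f.mem_coboundaries_of_injective hf' (M.bracket_mem_cocycles hz hz) hzz)
    rw [← hb, hH, LinearMap.zero_apply]
  obtain ⟨y, hy, rfl⟩ :=
    g.exists_isMaurerCartanSeries_of_map_bracket_self_eq_zero hg hg' hH hz hgz
  exact ⟨f.toLin ∘ y, f.isMaurerCartanSeries_comp hy, a, ha, hza⟩

/-! ### Evaluation of series at a nilpotent element -/

section Evaluation

variable (L : DGLieAlgebra.{u, v} K) {A : Type w₁} [CommRing A] [Algebra K A]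
  {B : Type w₂} [CommRing B] [Algebra K B] {n : ℕ} {y : ℕ → L.carrier}

/-- The value `∑ yᵢ ⊗ τⁱ`, `i < n`, of a formal series at an element `τ` of `A` with `τⁿ = 0`. -/
noncomputable def evalSeries (τ : A) (n : ℕ) : (ℕ → L.carrier) →ₗ[K] L.carrier ⊗[K] A :=
  ∑ i ∈ range n, (TensorProduct.mk K L.carrier A).flip (τ ^ i) ∘ₗ LinearMap.proj i

theorem evalSeries_apply (τ : A) (n : ℕ) (y : ℕ → L.carrier) :
    L.evalSeries τ n y = ∑ i ∈ range n, y i ⊗ₜ (τ ^ i) := by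
  simp [evalSeries]

theorem evalSeries_eq_of_le {τ : A} {m : ℕ} (hτ : τ ^ m = 0) (h : m ≤ n) (y : ℕ → L.carrier) :
    L.evalSeries τ n y = L.evalSeries τ m y := by
  simp only [evalSeries_apply]
  refine (sum_subset (range_mono h) fun i _ hi ↦ ?_).symm
  rw [pow_eq_zero_of_le (by simpa using hi) hτ, TensorProduct.tmul_zero]

theorem baseMap_evalSeries (φ : A →ₐ[K] B) (τ : A) (n : ℕ) (y : ℕ → L.carrier) :
    L.baseMap φ (L.evalSeries τ n y) = L.evalSeries (φ τ) n y := by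
  simp [evalSeries_apply, baseMap]

theorem tensorD_evalSeries (τ : A) (n : ℕ) (y : ℕ → L.carrier) :
    L.tensorD A (L.evalSeries τ n y) = L.evalSeries τ n (L.seriesD y) := by
  simp [evalSeries_apply, tensorD, seriesD_apply]

theorem tensorBracket_evalSeries {τ : A} (hτ : τ ^ n = 0) (x y : ℕ → L.carrier) :
    L.tensorBracket A (L.evalSeries τ n x) (L.evalSeries τ n y) =
      L.evalSeries τ n (L.seriesBracket x y) := by
  calc L.tensorBracket A (L.evalSeries τ n x) (L.evalSeries τ n y)
      = ∑ i ∈ range n, ∑ j ∈ range n, L.bracket (x i) (y j) ⊗ₜ (τ ^ (i + j)) := by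
        simp only [evalSeries_apply, tensorBracket, map_sum, LinearMap.sum_apply,
          TensorProduct.map₂_apply_tmul, pow_add]
        exact sum_comm
    _ = ∑ k ∈ range n, ∑ p ∈ antidiagonal k, L.bracket (x p.1) (y p.2) ⊗ₜ (τ ^ (p.1 + p.2)) :=
        sum_range_sum_range_eq_sum_antidiagonal fun i j h ↦ by
          rw [pow_eq_zero_of_le h hτ, TensorProduct.tmul_zero]
    _ = L.evalSeries τ n (L.seriesBracket x y) := by
        simp only [evalSeries_apply, seriesBracket_apply, TensorProduct.sum_tmul]
        refine sum_congr rfl fun k _ ↦ sum_congr rfl fun p hp ↦ ?_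
        rw [HasAntidiagonal.mem_antidiagonal.mp hp]

theorem curvature_evalSeries {τ : A} (hτ : τ ^ n = 0) (y : ℕ → L.carrier) :
    L.tensorD A (L.evalSeries τ n y) + (1 / 2 : K) •
      L.tensorBracket A (L.evalSeries τ n y) (L.evalSeries τ n y) =
      L.evalSeries τ n (L.seriesCurvature y) := by
  rw [tensorD_evalSeries, tensorBracket_evalSeries L hτ, seriesCurvature, map_add, map_smul]

variable {L}

theorem evalSeries_two {τ : A} (hy₀ : y 0 = 0) : L.evalSeries τ 2 y = y 1 ⊗ₜ τ := by
  simp [evalSeries_apply, sum_range_succ, hy₀]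

variable [IsLocalRing A] {τ : A}

theorem evalSeries_mem_tensorMax (hτ : τ ∈ IsLocalRing.maximalIdeal A) {i : ℤ} (hy₀ : y 0 = 0)
    (hy : ∀ m, y m ∈ L.deg i) : L.evalSeries τ n y ∈ L.tensorMax A i := by
  rw [evalSeries_apply]
  refine Submodule.sum_mem _ fun m _ ↦ ?_
  rcases m.eq_zero_or_pos with rfl | hm
  · simp [hy₀]
  · exact ⟨⟨y m, hy m⟩ ⊗ₜ ⟨τ ^ m, Ideal.pow_mem_of_mem _ hτ m hm⟩, by simp⟩

/-- The Maurer-Cartan element of `L ⊗ A` obtained from a Maurer-Cartan series by putting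
`t = τ`. -/
noncomputable def MaurerCartan.ofSeries (hy : L.IsMaurerCartanSeries y) (hτ : τ ^ n = 0) :
    L.MaurerCartan A :=
  ⟨L.evalSeries τ n y,
    evalSeries_mem_tensorMax
      (Ideal.IsPrime.mem_of_pow_mem inferInstance n (hτ ▸ Ideal.zero_mem _))
      hy.coeff_zero hy.mem, by
      rw [curvature_evalSeries L hτ, hy.curvature_eq_zero, map_zero]⟩

end Evaluation

/-! ### Gauge equivalence and formal series over `K[t]/(t^n)` -/

section Gauge

variable {L : DGLieAlgebra.{u, v} K} {A : Type w} [CommRing A] [Algebra K A]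

theorem gauge_eq_sub_tensorD {a x : L.carrier ⊗[K] A} (hax : L.tensorBracket A a x = 0)
    (haa : L.tensorBracket A a (L.tensorD A a) = 0) : L.gauge a x = x - L.tensorD A a := by
  rw [gauge, hax, zero_sub, finsum_eq_single _ 0]
  · simp [sub_eq_add_neg]
  · intro n hn
    obtain ⟨n, rfl⟩ := Nat.exists_eq_succ_of_ne_zero hn
    rw [Nat.succ_eq_add_one, pow_succ, Module.End.mul_apply, map_neg, haa, neg_zero, map_zero,
      smul_zero]

theorem gaugeRel_of_eq_add_d [IsLocalRing A] {τ : A} (hτ : τ ^ 2 = 0) {x y : L.MaurerCartan A}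
    {v a : L.carrier} (ha : a ∈ L.deg 0) (hx : x.1 = (v + L.d a) ⊗ₜ τ) (hy : y.1 = v ⊗ₜ τ) :
    L.GaugeRel A x y := by
  have hbracket : ∀ z, L.tensorBracket A (a ⊗ₜ τ) (z ⊗ₜ τ) = 0 := fun z ↦ by
    simp [tensorBracket, ← pow_two, hτ]
  have hd : L.tensorD A (a ⊗ₜ τ) = L.d a ⊗ₜ τ := LinearMap.rTensor_tmul ..
  have hτ' : τ ∈ IsLocalRing.maximalIdeal A :=
    Ideal.IsPrime.mem_of_pow_mem inferInstance 2 (hτ ▸ Ideal.zero_mem _)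
  refine ⟨a ⊗ₜ τ, ⟨⟨a, ha⟩ ⊗ₜ ⟨τ, hτ'⟩, rfl⟩, ?_⟩
  rw [hx, hy, gauge_eq_sub_tensorD (hbracket _) (hd ▸ hbracket _), hd, ← TensorProduct.sub_tmul,
    add_sub_cancel_right]

end Gauge

end DGLieAlgebra

namespace TruncPoly

open Polynomial

/-- The class of the variable `t` in `K[t]/(t^n)`. -/
noncomputable def t (K : Type u) [Field K] (n : ℕ) : TruncPoly K n := Ideal.Quotient.mk _ X

variable {K : Type u} [Field K] {n : ℕ}

theorem t_pow_self (n : ℕ) : t K n ^ n = 0 :=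
  Ideal.Quotient.eq_zero_iff_mem.mpr (Ideal.mem_span_singleton_self _)

theorem proj_t {m : ℕ} (h : m ≤ n) : proj K h (t K n) = t K m := rfl

/-- The basis `1, t, …, t^{n-1}` of `K[t]/(t^n)`. -/
noncomputable def powBasis (K : Type u) [Field K] (n : ℕ) :
    Module.Basis (Fin n) K (TruncPoly K n) :=
  (AdjoinRoot.powerBasis' (monic_X_pow n)).basis.reindex (finCongr (natDegree_X_pow n))

theorem powBasis_apply (i : Fin n) : powBasis K n i = t K n ^ (i : ℕ) := by
  let b := AdjoinRoot.powerBasis' (monic_X_pow (R := K) n)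
  exact (b.basis.reindex_apply (finCongr (natDegree_X_pow n)) i).trans (b.basis_eq_pow _)

theorem mk_eq_sum_coeff_smul_t_pow (q : K[X]) :
    (Ideal.Quotient.mk _ q : TruncPoly K n) = ∑ i ∈ range n, q.coeff i • t K n ^ i := by
  have h : ∑ i ∈ range n, q.coeff i • t K n ^ i =
      (Ideal.Quotient.mk _ (∑ i ∈ range n, q.coeff i • X ^ i) : TruncPoly K n) :=
    (map_sum (Ideal.Quotient.mk _) (fun i ↦ q.coeff i • X ^ i) _).symm
  rw [h, Ideal.Quotient.eq, Ideal.mem_span_singleton, X_pow_dvd_iff]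
  intro d hd
  simp [coeff_X_pow, hd]

theorem coeff_zero_of_mk_mem_maximalIdeal [NeZero n] {q : K[X]}
    (hq : (Ideal.Quotient.mk _ q : TruncPoly K n) ∈ IsLocalRing.maximalIdeal (TruncPoly K n)) :
    q.coeff 0 = 0 := by
  obtain ⟨N, hN⟩ := (Ring.KrullDimLE.isNilpotent_iff_mem_maximalIdeal).mpr hq
  rw [← map_pow, Ideal.Quotient.eq_zero_iff_mem, Ideal.mem_span_singleton] at hN
  exact X_dvd_iff.mp (prime_X.dvd_of_dvd_pow ((dvd_pow_self X (NeZero.ne n)).trans hN))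

theorem exists_eq_sum_of_mem_maximalIdeal [NeZero n] {p : TruncPoly K n}
    (hp : p ∈ IsLocalRing.maximalIdeal (TruncPoly K n)) :
    ∃ c : ℕ → K, c 0 = 0 ∧ p = ∑ i ∈ range n, c i • t K n ^ i := by
  obtain ⟨q, rfl⟩ := Ideal.Quotient.mk_surjective p
  exact ⟨q.coeff, coeff_zero_of_mk_mem_maximalIdeal hp, mk_eq_sum_coeff_smul_t_pow q⟩

end TruncPoly

namespace DGLieAlgebra

open TruncPoly

variable {K : Type u} [Field K] {L : DGLieAlgebra.{u, v} K} {n : ℕ}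

theorem eq_zero_of_evalSeries_t_eq_zero {y : ℕ → L.carrier} (h : L.evalSeries (t K n) n y = 0)
    {i : ℕ} (hi : i < n) : y i = 0 := by
  have hzero := TensorProduct.sum_tmul_basis_right_eq_zero (powBasis K n)
    (Finsupp.equivFunOnFinite.symm fun i : Fin n ↦ y i) (by
      rw [Finsupp.sum_fintype _ _ (by simp), ← h, evalSeries_apply,
        ← Fin.sum_univ_eq_sum_range fun i ↦ y i ⊗ₜ (t K n ^ i)]
      simp [powBasis_apply])
  exact DFunLike.congr_fun hzero ⟨i, hi⟩

theorem exists_evalSeries_t_eq [NeZero n] {k : ℤ} {x : L.carrier ⊗[K] TruncPoly K n}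
    (hx : x ∈ L.tensorMax (TruncPoly K n) k) :
    ∃ y : ℕ → L.carrier, y 0 = 0 ∧ (∀ i, y i ∈ L.deg k) ∧ L.evalSeries (t K n) n y = x := by
  obtain ⟨x, rfl⟩ := hx
  induction x with
  | zero => exact ⟨0, rfl, fun _ ↦ Submodule.zero_mem _, by simp⟩
  | tmul l p =>
    obtain ⟨c, hc₀, hc⟩ := exists_eq_sum_of_mem_maximalIdeal p.2
    refine ⟨fun i ↦ c i • l, by simp [hc₀], fun i ↦ Submodule.smul_mem _ _ l.2, ?_⟩
    rw [TensorProduct.map_tmul, Submodule.subtype_apply, Submodule.subtype_apply, hc,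
      TensorProduct.tmul_sum, evalSeries_apply]
    simp only [TensorProduct.smul_tmul]
  | add x₁ x₂ h₁ h₂ =>
    obtain ⟨y₁, hy₁, hy₁', hx₁⟩ := h₁
    obtain ⟨y₂, hy₂, hy₂', hx₂⟩ := h₂
    refine ⟨y₁ + y₂, by simp [hy₁, hy₂], fun i ↦ Submodule.add_mem _ (hy₁' i) (hy₂' i), ?_⟩
    rw [map_add, map_add, hx₁, hx₂]

theorem MaurerCartan.exists_evalSeries_eq [NeZero n] (x : L.MaurerCartan (TruncPoly K n)) :
    ∃ y : ℕ → L.carrier, y 0 = 0 ∧ (∀ i, y i ∈ L.deg 1) ∧ L.evalSeries (t K n) n y = x.1 ∧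
      ∀ i < n, L.seriesCurvature y i = 0 := by
  obtain ⟨y, hy₀, hy, hx⟩ := exists_evalSeries_t_eq x.2.1
  refine ⟨y, hy₀, hy, hx, fun i hi ↦ eq_zero_of_evalSeries_t_eq_zero ?_ hi⟩
  rw [← curvature_evalSeries L (t_pow_self n), hx]
  exact x.2.2

/-- The element of `Def_L(K[[t]])` defined by a Maurer-Cartan series. -/
noncomputable def DefPowerSeries.ofSeries {y : ℕ → L.carrier} (hy : L.IsMaurerCartanSeries y) :
    L.DefPowerSeries :=
  ⟨fun n _ ↦ Quot.mk _ (MaurerCartan.ofSeries hy (t_pow_self n)), fun m n _ _ h ↦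
    congrArg (Quot.mk _) (Subtype.ext <|
      (L.baseMap_evalSeries (proj K h) (t K n) n y).trans
        (L.evalSeries_eq_of_le (t_pow_self m) h y))⟩

end DGLieAlgebra

open DGLieAlgebra TruncPoly in
theorem proposition8p1_general {K : Type u} [Field K] [CharZero K] {L : DGLieAlgebra.{u, v} K}
    {M : DGLieAlgebra.{u, w₁} K} {H : DGLieAlgebra.{u, w₂} K} (f : Hom M L) (g : Hom M H)
    (hf : Function.Surjective (f.cohomologyMap 1)) (hf' : Function.Injective (f.cohomologyMap 2))
    (hg : Function.Surjective (g.cohomologyMap 1)) (hg' : Function.Injective (g.cohomologyMap 2))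
    (hH : H.d = 0) :
    Set.range (Def.map L (proj K (show 2 ≤ 3 by norm_num))) =
      Set.range (DefPowerSeries.eval L 2) := by
  apply Set.Subset.antisymm
  · rintro _ ⟨q, rfl⟩
    obtain ⟨x, rfl⟩ := Quot.exists_rep q
    obtain ⟨z, hz₀, hz, hzx, hcurv⟩ := MaurerCartan.exists_evalSeries_eq x
    obtain ⟨y, hy, a, ha, hya⟩ := exists_isMaurerCartanSeries f g hf hf' hg hg' hH
      (coeff_one_mem_cocycles hz₀ (hz 1) (hcurv 1 (by norm_num)))
      (bracket_coeff_one_mem_coboundaries hz₀ (hz 2) (hcurv 2 (by norm_num)))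
    have hy₁ : L.evalSeries (t K 2) 2 y = (z 1 + L.d a) ⊗ₜ t K 2 := by
      rw [evalSeries_two hy.coeff_zero, hya]
    have hx₁ : L.baseMap (proj K (show 2 ≤ 3 by norm_num)) x.1 = z 1 ⊗ₜ t K 2 := by
      rw [← hzx, baseMap_evalSeries, proj_t, evalSeries_eq_of_le L (t_pow_self 2) (by norm_num),
        evalSeries_two hz₀]
    exact ⟨.ofSeries hy, Quot.sound (gaugeRel_of_eq_add_d (t_pow_self 2) ha hy₁ hx₁)⟩
  · rintro _ ⟨s, rfl⟩
    exact ⟨s.1 3, s.2 2 3 _⟩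

theorem proposition8p1 {K : Type u} [Field K] [CharZero K] (L : DGLieAlgebra.{u, v} K)
    (hL : DGLieAlgebra.IsFormal.{u, v, w₁, w₂} L) :
    Set.range (DGLieAlgebra.Def.map L (TruncPoly.proj K (show 2 ≤ 3 by norm_num))) =
      Set.range (DGLieAlgebra.DefPowerSeries.eval L 2) := by
  obtain ⟨M, H, f, g, hf, hg, hH⟩ := hL
  exact proposition8p1_general f g (hf 1).2 (hf 2).1 (hg 1).2 (hg 2).1 hH
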